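/- Let $n,m\ge 3$ be (finite or infinite) cardinal numbers and let $A_{n,m}$ be the $(n,m)$-biregular tree, i.e. a tree (a connected graph without cycles) whose vertices are coloured with two colours $0,1$ so that every vertex of colour $0$ has exactly $n$ neighbours of colour $1$ and none of colour $0$, and every vertex of colour $1$ has exactly $m$ neighbours of colour $0$ and none of colour $1$. Let $\mathrm{Aut}(A_{n,m})$ be the group of all automorphisms of the (uncoloured) tree, and let $\mathrm{Aut}^+(A_{n,m})$ be its subgroup generated by the pointwise stabilizers of edges. Then $\mathrm{Aut}^+(A_{n,m})$ has index at most two in $\mathrm{Aut}(A_{n,m})$, and it is $32$-boundedly simple: for every nontrivial $g\in\mathrm{Aut}^+(A_{n,m})$, every element of $\mathrm{Aut}^+(A_{n,m})$ is a product of at most $32$ elements, each of which is conjugate in $\mathrm{Aut}^+(A_{n,m})$ to $g$ or to $g^{-1}$. -/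

import Mathlib

universe u

/-- A group `G` is `N`-boundedly simple if for every nontrivial `g`, every element of `G` is a
product of at most `N` conjugates (in `G`) of `g` and `g⁻¹`. -/
def IsBoundedlySimple (N : ℕ) (G : Type*) [Group G] : Prop :=
  ∀ g : G, g ≠ 1 → ∀ h : G, ∃ L : List G,
    L.length ≤ N ∧ (∀ c ∈ L, IsConj g c ∨ IsConj g⁻¹ c) ∧ L.prod = h

namespace SimpleGraph

variable {V : Type u}

/-- The pointwise stabilizer, in the full automorphism group, of the pair of vertices `x, y`. -/
def pairStabilizer (T : SimpleGraph V) (x y : V) : Subgroup (T ≃g T) where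
  carrier := {α | α x = x ∧ α y = y}
  one_mem' := ⟨rfl, rfl⟩
  mul_mem' := by
    rintro α β ⟨h1, h2⟩ ⟨h3, h4⟩
    exact ⟨by rw [RelIso.mul_apply, h3, h1], by rw [RelIso.mul_apply, h4, h2]⟩
  inv_mem' := by
    rintro α ⟨h1, h2⟩
    exact ⟨α.symm_apply_eq.2 h1.symm, α.symm_apply_eq.2 h2.symm⟩

/-- The subgroup of the full automorphism group generated by the (pointwise) stabilizers of
edges. -/
def autPlus (T : SimpleGraph V) : Subgroup (T ≃g T) :=
  ⨆ (x : V) (y : V) (_ : T.Adj x y), T.pairStabilizer x y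

/-- The coloring `f` of the vertices has code `a`: every vertex of color `i` has exactly `a i j`
neighbours of color `j`. -/
def HasCode {I : Type*} (T : SimpleGraph V) (f : V → I) (a : I → I → Cardinal.{u}) : Prop :=
  ∀ (i j : I) (x : V), f x = i → Cardinal.mk {y : V // f y = j ∧ T.Adj x y} = a i j

/-- The code with `a(0,0) = a(1,1) = 0`, `a(0,1) = n`, `a(1,0) = m`. -/
def biregularCode (n m : Cardinal.{u}) : Fin 2 → Fin 2 → Cardinal.{u} :=
  ![![0, n], ![m, 0]]

/-- `T`, with the vertex coloring `f`, is the `(n, m)`-biregular tree. -/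
structure IsBiregularTree (T : SimpleGraph V) (f : V → Fin 2) (n m : Cardinal.{u}) : Prop where
  isTree : T.IsTree
  hasCode : T.HasCode f (biregularCode n m)

end SimpleGraph

/-! ### Distances and geodesics in trees -/

namespace SimpleGraph

variable {V : Type u} {T : SimpleGraph V}

/-! The group `Aut⁺` turns out to be the group `G` of colour-preserving automorphisms. An
automorphism that preserves the colour of one vertex preserves all colours, whence the index bound.

Bounded simplicity rests on translations. Call `h` a translation if it carries some oriented edge
`ab` to an edge `cd` further along a geodesic `a, b, …, c, d`. The region between `ab` and `cd` is
then a fundamental domain for `h`, so two elements of `G` carrying `ab` to the same `cd` are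
conjugate in `G` (`exists_conj_of_coherent`): on the `k`-th translate of the region, conjugate by
`h' ^ k * (h ^ k)⁻¹`.

A nontrivial `g` yields a translation `h` as a product of at most two conjugates of `g`. If `e`
fixes a vertex, some conjugate `h₁` of `h` is such that `e * h₁` is again conjugate to `h`, so `e =
(e * h₁) * h₁⁻¹` costs four conjugates of `g` or `g⁻¹`. Every element of `G` is a product of two
elements with fixed vertices, which gives 8, well below 32.

The automorphisms needed come from `IsHomogeneous.exists_iso`, which glues bijections between
neighbour sets outwards from a base vertex. -/

theorem Connected.exists_adj_dist_add_one (hT : T.Connected) {p u : V} (h : u ≠ p) :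
    ∃ v, T.Adj u v ∧ T.dist p v + 1 = T.dist p u := by
  obtain ⟨w, hw⟩ := hT.exists_walk_length_eq_dist u p
  cases w with
  | nil => exact absurd rfl h
  | @cons _ v _ huv q =>
    refine ⟨v, huv, ?_⟩
    have h1 := dist_le q
    have h2 : T.dist p u ≤ T.dist p v + T.dist v u := hT.dist_triangle
    have h3 : T.dist v u = 1 := dist_eq_one_iff_adj.2 huv.symm
    have h4 : T.dist p v = T.dist v p := dist_comm
    have h5 : T.dist p u = T.dist u p := dist_comm
    rw [Walk.length_cons] at hw
    omega

/-- Two such neighbours would be penultimate vertices of two geodesics from `p` to `u`, but paths in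
a tree are unique. -/
theorem IsTree.eq_of_adj_of_dist_lt (hT : T.IsTree) {p u v w : V} (hv : T.Adj u v)
    (hw : T.Adj u w) (hv' : T.dist p v < T.dist p u) (hw' : T.dist p w < T.dist p u) : v = w := by
  have key : ∀ {x : V}, T.Adj u x → T.dist p x < T.dist p u →
      ∃ c : T.Walk p u, c.IsPath ∧ x = c.penultimate := by
    intro x hx hx'
    obtain ⟨q, hq⟩ := hT.connected.exists_walk_length_eq_dist p x
    have h1 := hT.dist_eq_dist_add_one_of_adj p hx
    refine ⟨q.concat hx.symm, Walk.isPath_of_length_eq_dist _ ?_, by simp⟩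
    rw [Walk.length_concat]
    omega
  obtain ⟨c, hc, rfl⟩ := key hv hv'
  obtain ⟨c', hc', rfl⟩ := key hw hw'
  have := (hT.existsUnique_path p u).unique hc hc'
  rw [this]

/-- Extending a geodesic by an edge that does not backtrack. -/
theorem IsTree.dist_eq_add_one_of_ne (hT : T.IsTree) {p u v w : V} (hv : T.Adj u v)
    (hw : T.Adj u w) (hv' : T.dist p v < T.dist p u) (hne : w ≠ v) :
    T.dist p w = T.dist p u + 1 := by
  rcases hT.dist_eq_dist_add_one_of_adj p hw with h | h
  · exact absurd (hT.eq_of_adj_of_dist_lt hw hv (by omega) hv') hne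
  · exact h

theorem IsTree.dist_eq_two (hT : T.IsTree) {u v w : V} (hv : T.Adj u v) (hw : T.Adj u w)
    (hne : v ≠ w) : T.dist v w = 2 := by
  have h1 : T.dist v u = 1 := dist_eq_one_iff_adj.2 hv.symm
  rw [hT.dist_eq_add_one_of_ne hv hw (by simp [h1]) hne.symm, h1]

theorem Connected.exists_dist_eq_of_le (hT : T.Connected) {p q : V} {k : ℕ} (hk : k ≤ T.dist p q) :
    ∃ r, T.dist p r = k ∧ T.dist r q + k = T.dist p q := by
  obtain ⟨j, hj⟩ := Nat.exists_eq_add_of_le hk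
  induction j generalizing q with
  | zero => exact ⟨q, by simpa using hj, by simp; omega⟩
  | succ j ih =>
    obtain ⟨v, hv, hd⟩ := hT.exists_adj_dist_add_one (p := p) (u := q) (by
      rintro rfl
      simp at hj)
    obtain ⟨r, h1, h2⟩ := ih (q := v) (by omega) (by omega)
    refine ⟨r, h1, ?_⟩
    have h3 : T.dist r q ≤ T.dist r v + T.dist v q := hT.dist_triangle
    have h4 : T.dist v q = 1 := dist_eq_one_iff_adj.2 hv.symm
    have h5 : T.dist p q ≤ T.dist p r + T.dist r q := hT.dist_triangle
    omega

/-- The only edge leaving the half-tree of points closer to `b` than to `a` is the edge `ba`. -/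
theorem IsTree.eq_and_eq_of_adj_of_dist (hT : T.IsTree) {a b p q : V} (hab : T.Adj a b)
    (hpq : T.Adj p q) (hp : T.dist b p < T.dist a p) (hq : T.dist a q < T.dist b q) :
    p = b ∧ q = a := by
  have e : ∀ x, T.dist a x = T.dist b x + 1 ∨ T.dist b x = T.dist a x + 1 := fun x => by
    rw [dist_comm (u := a), dist_comm (u := b)]
    exact hT.dist_eq_dist_add_one_of_adj x hab
  have hp' := e p
  have hq' := e q
  have h1 := hT.dist_eq_dist_add_one_of_adj a hpq
  have h2 := hT.dist_eq_dist_add_one_of_adj b hpq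
  have hpb : p = b := by
    by_contra hne
    obtain ⟨r, hr, hr'⟩ := hT.connected.exists_adj_dist_add_one hne
    have h3 := e r
    have : r = q := hT.eq_of_adj_of_dist_lt (p := a) hr hpq (by omega) (by omega)
    subst this
    omega
  subst hpb
  refine ⟨rfl, ?_⟩
  rw [dist_self] at h2
  exact (hT.connected.dist_eq_zero_iff.1 (by omega)).symm

/-- Walk from `x` towards `p`: the only edge leading to the half-tree of `p` is `cd`. -/
theorem IsTree.dist_eq_of_separated (hT : T.IsTree) {c d p x : V} (hcd : T.Adj c d)
    (hp : T.dist d p < T.dist c p) (hx : T.dist c x < T.dist d x) :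
    T.dist x p = T.dist c x + 1 + T.dist d p := by
  induction hk : T.dist x p generalizing x with
  | zero =>
    obtain rfl := hT.connected.dist_eq_zero_iff.1 hk
    omega
  | succ k ih =>
    have hne : x ≠ p := by
      rintro rfl
      simp at hk
    obtain ⟨y, hy, hd⟩ := hT.connected.exists_adj_dist_add_one hne
    have c1 : T.dist p y = T.dist y p := dist_comm
    have c2 : T.dist p x = T.dist x p := dist_comm
    have h1 := hT.dist_ne_of_adj y hcd
    rw [dist_comm (u := y) (v := c), dist_comm (u := y) (v := d)] at h1
    rcases lt_or_gt_of_ne h1 with h1 | h1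
    · have h2 := ih h1 (by omega)
      have h3 := hT.dist_eq_dist_add_one_of_adj c hy
      have h4 : T.dist x p ≤ T.dist c x + T.dist c p := by
        rw [dist_comm (u := c) (v := x)]
        exact hT.connected.dist_triangle
      have h5 := hT.dist_eq_dist_add_one_of_adj p hcd
      rw [dist_comm (u := p) (v := c), dist_comm (u := p) (v := d)] at h5
      omega
    · obtain ⟨rfl, rfl⟩ := hT.eq_and_eq_of_adj_of_dist hcd hy.symm h1 hx
      simp
      omega

theorem Iso.dist_apply (α : T ≃g T) (u v : V) : T.dist (α u) (α v) = T.dist u v := by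
  have key : ∀ (β : T ≃g T) (x y : V), T.dist (β x) (β y) ≤ T.dist x y := by
    intro β x y
    by_cases h : T.Reachable x y
    · obtain ⟨w, hw⟩ := h.exists_walk_length_eq_dist
      rw [← hw, ← Walk.length_map β.toHom w]
      exact dist_le _
    · rw [dist_eq_zero_of_not_reachable h, dist_eq_zero_of_not_reachable]
      exact fun h' => h (by simpa using h'.map β.symm.toHom)
  refine le_antisymm (key α u v) ?_
  simpa using key α.symm (α u) (α v)

end SimpleGraph

/-! ### Translations and their conjugacy -/

namespace SimpleGraph

variable {V : Type u} {T : SimpleGraph V}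

/-- The oriented edges `ab` and `cd` are consecutive on a geodesic `a, b, …, c, d`. -/
structure Coherent (T : SimpleGraph V) (a b c d : V) : Prop where
  adj_left : T.Adj a b
  adj_right : T.Adj c d
  dist_eq : T.dist a d = T.dist b c + 2

namespace Coherent

variable {a b c d : V}

theorem dist_mid (H : T.Coherent a b c d) (hT : T.IsTree) : T.dist a c = T.dist b c + 1 := by
  have h1 := hT.dist_eq_dist_add_one_of_adj c H.adj_left
  rw [dist_comm (u := c), dist_comm (u := c) (v := b)] at h1
  have h2 := hT.dist_eq_dist_add_one_of_adj a H.adj_right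
  have h3 := H.dist_eq
  omega

theorem dist_right (H : T.Coherent a b c d) (hT : T.IsTree) : T.dist b d = T.dist b c + 1 := by
  have h1 := hT.dist_eq_dist_add_one_of_adj d H.adj_left
  rw [dist_comm (u := d), dist_comm (u := d) (v := b)] at h1
  have h2 := hT.dist_eq_dist_add_one_of_adj b H.adj_right
  have h3 := H.dist_eq
  omega

theorem symm (H : T.Coherent a b c d) : T.Coherent d c b a :=
  ⟨H.adj_right.symm, H.adj_left.symm, by
    rw [dist_comm (u := d), H.dist_eq, dist_comm (u := b)]⟩

theorem map (H : T.Coherent a b c d) (α : T ≃g T) : T.Coherent (α a) (α b) (α c) (α d) :=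
  ⟨α.map_adj_iff.2 H.adj_left, α.map_adj_iff.2 H.adj_right, by
    rw [Iso.dist_apply, Iso.dist_apply, H.dist_eq]⟩

theorem dist_of_beyond (H : T.Coherent a b c d) (hT : T.IsTree) {p : V}
    (hp : T.dist d p < T.dist c p) :
    T.dist b p < T.dist a p ∧ T.dist c p < T.dist a p := by
  have h0 := H.dist_eq
  have h1 := H.dist_mid hT
  have h2 := H.dist_right hT
  have e1 := hT.dist_eq_of_separated H.adj_right hp (x := a)
    (by rw [dist_comm (u := c), dist_comm (u := d)]; omega)
  have e2 := hT.dist_eq_of_separated H.adj_right hp (x := b)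
    (by rw [dist_comm (u := c), dist_comm (u := d)]; omega)
  rw [dist_comm (u := c)] at e1 e2
  have e3 := hT.dist_eq_dist_add_one_of_adj p H.adj_right
  rw [dist_comm (u := p), dist_comm (u := p) (v := d)] at e3
  omega

theorem dist_of_before (H : T.Coherent a b c d) (hT : T.IsTree) {p : V}
    (hp : ¬ T.dist b p < T.dist a p) : T.dist a p < T.dist c p := by
  have h1 := H.dist_mid hT
  have e := hT.dist_ne_of_adj p H.adj_left
  rw [dist_comm (u := p), dist_comm (u := p) (v := b)] at e
  have e1 := hT.dist_eq_of_separated H.adj_left (p := c) (x := p) (by omega) (by omega)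
  rw [dist_comm (u := p)] at e1
  omega

end Coherent

/-- The translate by `h ^ k` of the half-tree beyond the edge `ab` contains `p`. -/
def InTranslate (h : T ≃g T) (a b p : V) (k : ℤ) : Prop :=
  T.dist b ((h ^ k)⁻¹ p) < T.dist a ((h ^ k)⁻¹ p)

/-- `p` lies in the translate by `h ^ k` of the region between the edge `ab` and its image. -/
def IsLevel (h : T ≃g T) (a b p : V) (k : ℤ) : Prop :=
  InTranslate h a b p k ∧ ¬ InTranslate h a b p (k + 1)

section

variable {a b c d : V} {h h' : T ≃g T}

theorem dist_inv_lt_iff (ha : h a = c) (hb : h b = d) (q : V) :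
    T.dist b (h⁻¹ q) < T.dist a (h⁻¹ q) ↔ T.dist d q < T.dist c q := by
  rw [← Iso.dist_apply h b, ← Iso.dist_apply h a, RelIso.apply_inv_self, ha, hb]

theorem inTranslate_apply_zpow (p : V) (j k : ℤ) :
    InTranslate h a b ((h ^ j) p) (j + k) ↔ InTranslate h a b p k := by
  unfold InTranslate
  rw [zpow_add, mul_inv_rev, RelIso.mul_apply, RelIso.inv_apply_self]

theorem inTranslate_inv_zpow (p : V) (j k : ℤ) :
    InTranslate h a b ((h ^ j)⁻¹ p) k ↔ InTranslate h a b p (j + k) := by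
  rw [← inTranslate_apply_zpow _ j, RelIso.apply_inv_self]

theorem inTranslate_zero {p : V} :
    InTranslate h a b p 0 ↔ T.dist b p < T.dist a p := by
  simp [InTranslate]

theorem inTranslate_one (ha : h a = c) (hb : h b = d) {p : V} :
    InTranslate h a b p 1 ↔ T.dist d p < T.dist c p := by
  rw [← dist_inv_lt_iff ha hb]
  simp [InTranslate]

variable (hT : T.IsTree) (H : T.Coherent a b c d) (ha : h a = c) (hb : h b = d)
include hT H ha hb

theorem InTranslate.of_add_one {p : V} {k : ℤ} (hp : InTranslate h a b p (k + 1)) :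
    InTranslate h a b p k := by
  rw [← inTranslate_inv_zpow, inTranslate_one ha hb] at hp
  rw [← add_zero k, ← inTranslate_inv_zpow, inTranslate_zero]
  exact (H.dist_of_beyond hT hp).1

theorem InTranslate.anti {p : V} {j k : ℤ} (hjk : j ≤ k) (hp : InTranslate h a b p k) :
    InTranslate h a b p j := by
  obtain ⟨n, rfl⟩ := Int.le.dest hjk
  induction n with
  | zero => simpa using hp
  | succ n ih =>
    refine ih (by omega) (InTranslate.of_add_one hT H ha hb ?_)
    simpa [add_assoc] using hp

omit hb in
-- If `p` lies before `ab`, then `h p` is strictly nearer to `c` than `p` is, since `dist c (h p) =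
-- dist a p < dist c p`.
theorem exists_inTranslate (p : V) : ∃ k, InTranslate h a b p k := by
  induction hn : T.dist c p using Nat.strong_induction_on generalizing p with
  | _ n ih =>
    by_cases h0 : T.dist b p < T.dist a p
    · exact ⟨0, inTranslate_zero.2 h0⟩
    · have h1 := H.dist_of_before hT h0
      rw [← Iso.dist_apply h a, ha, hn] at h1
      obtain ⟨k, hk⟩ := ih _ h1 (h p) rfl
      refine ⟨-1 + k, ?_⟩
      rw [← inTranslate_inv_zpow]
      simpa using hk

/-- If `q` lies beyond `cd`, then `h⁻¹ q` is strictly nearer to `a` than `q` is, since `dist a (h⁻¹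
q) = dist c q < dist a q`. -/
theorem exists_not_inTranslate (p : V) (j : ℤ) :
    ∃ n : ℕ, ¬ InTranslate h a b p (j + n) := by
  suffices hq : ∀ q, ∃ n : ℕ, ¬ InTranslate h a b q n by
    obtain ⟨n, hn⟩ := hq ((h ^ j)⁻¹ p)
    exact ⟨n, by rwa [inTranslate_inv_zpow] at hn⟩
  intro q
  induction hn : T.dist a q using Nat.strong_induction_on generalizing q with
  | _ n ih =>
    by_cases h0 : T.dist d q < T.dist c q
    · have h1 := (H.dist_of_beyond hT h0).2
      rw [← RelIso.apply_inv_self h q, ← ha, Iso.dist_apply, RelIso.apply_inv_self, hn] at h1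
      obtain ⟨k, hk⟩ := ih _ h1 (h⁻¹ q) rfl
      refine ⟨k + 1, ?_⟩
      replace hk := (inTranslate_inv_zpow (h := h) q 1 k).not.1 (by rwa [zpow_one])
      rwa [Nat.cast_add, Nat.cast_one, add_comm]
    · exact ⟨1, by rwa [Nat.cast_one, inTranslate_one ha hb]⟩

theorem exists_isLevel (p : V) : ∃ k, IsLevel h a b p k := by
  obtain ⟨j, hj⟩ := exists_inTranslate hT H ha p
  obtain ⟨n, hn⟩ := exists_not_inTranslate hT H ha hb p j
  by_contra! hc
  refine hn ?_
  clear hn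
  induction n with
  | zero => simpa using hj
  | succ n ih =>
    have := hc (j + n)
    unfold IsLevel at this
    push Not at this
    simpa [add_assoc] using this ih

theorem IsLevel.le {p : V} {j k : ℤ} (hj : IsLevel h a b p j) (hk : InTranslate h a b p k) :
    k ≤ j := by
  by_contra! hc
  exact hj.2 (InTranslate.anti hT H ha hb (by omega) hk)

theorem IsLevel.unique {p : V} {j k : ℤ} (hj : IsLevel h a b p j) (hk : IsLevel h a b p k) :
    j = k :=
  le_antisymm (hk.le hT H ha hb hj.1) (hj.le hT H ha hb hk.1)

variable (ha' : h' a = c) (hb' : h' b = d)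
include ha' hb'

omit hT H in
theorem IsLevel.transfer {p : V} {k : ℤ} (hk : IsLevel h a b p k) :
    IsLevel h' a b ((h' ^ k * (h ^ k)⁻¹) p) k := by
  obtain ⟨h1, h2⟩ := hk
  rw [← inTranslate_inv_zpow, inTranslate_one ha hb] at h2
  rw [← add_zero k, ← inTranslate_inv_zpow, inTranslate_zero] at h1
  constructor
  · rw [← add_zero k, ← inTranslate_inv_zpow, inTranslate_zero]
    simpa using h1
  · rw [← inTranslate_inv_zpow, inTranslate_one ha' hb']
    simpa using h2

omit ha' in
theorem adj_of_isLevel_le {p q : V} {j k : ℤ} (hp : IsLevel h a b p k) (hq : IsLevel h a b q j)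
    (hkj : k ≤ j) (hpq : T.Adj p q) :
    T.Adj ((h' ^ k * (h ^ k)⁻¹) p) ((h' ^ j * (h ^ j)⁻¹) q) := by
  rcases hkj.eq_or_lt with rfl | hlt
  · exact (h' ^ k * (h ^ k)⁻¹).map_adj_iff.2 hpq
  have h1 := hp.2
  have h2 := InTranslate.anti hT H ha hb (Int.add_one_le_iff.2 hlt) hq.1
  rw [← inTranslate_inv_zpow, inTranslate_one ha hb] at h1 h2
  have h3 := hT.dist_ne_of_adj ((h ^ k)⁻¹ p) H.adj_right
  rw [dist_comm (u := _) (v := c), dist_comm (u := _) (v := d)] at h3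
  -- An edge joining different levels must be the boundary edge `h ^ k (cd)`, so the levels are
  -- consecutive. The two local maps fit together there because `h` and `h'` agree on `b`.
  obtain ⟨e1, e2⟩ := hT.eq_and_eq_of_adj_of_dist H.adj_right
    ((h ^ k)⁻¹.map_adj_iff.2 hpq.symm) h2 (by omega)
  have e3 : q = (h ^ (k + 1)) b := by
    rw [zpow_add_one, RelIso.mul_apply, hb, ← e1, RelIso.apply_inv_self]
  have hj : j = k + 1 := by
    refine hq.unique hT H ha hb ⟨?_, ?_⟩
    · rwa [← inTranslate_inv_zpow, inTranslate_one ha hb]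
    · rw [e3, inTranslate_apply_zpow, inTranslate_one ha hb, dist_comm, H.dist_right hT,
        dist_comm (u := c)]
      omega
  subst hj
  rw [RelIso.mul_apply, RelIso.mul_apply, e2, e3, RelIso.inv_apply_self, zpow_add_one,
    RelIso.mul_apply, hb']
  exact (h' ^ k).map_adj_iff.2 H.adj_right

/-- Two automorphisms translating the edge `ab` to a coherent edge `cd` are conjugate, by an
automorphism that agrees at each vertex with a product of powers of the two. -/
theorem exists_conj_of_coherent :
    ∃ x : T ≃g T, x * h = h' * x ∧ ∀ p, ∃ k : ℤ, x p = (h' ^ k * (h ^ k)⁻¹) p := by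
  choose i hi using exists_isLevel hT H ha hb
  choose i' hi' using exists_isLevel hT H ha' hb'
  have e1 : ∀ p, i' ((h' ^ i p * (h ^ i p)⁻¹) p) = i p := fun p =>
    (hi' _).unique hT H ha' hb' ((hi p).transfer ha hb ha' hb')
  have e2 : ∀ p, i ((h ^ i' p * (h' ^ i' p)⁻¹) p) = i' p := fun p =>
    (hi _).unique hT H ha hb ((hi' p).transfer ha' hb' ha hb)
  let e : V ≃ V :=
    { toFun := fun p => (h' ^ i p * (h ^ i p)⁻¹) p
      invFun := fun p => (h ^ i' p * (h' ^ i' p)⁻¹) p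
      left_inv := fun p => by
        simp only [e1]
        simp
      right_inv := fun p => by
        simp only [e2]
        simp }
  have adj : ∀ {p q : V}, T.Adj p q → T.Adj (e p) (e q) := by
    intro p q hpq
    rcases le_total (i p) (i q) with hle | hle
    · exact adj_of_isLevel_le hT H ha hb hb' (hi p) (hi q) hle hpq
    · exact (adj_of_isLevel_le hT H ha hb hb' (hi q) (hi p) hle hpq.symm).symm
  have adj' : ∀ {p q : V}, T.Adj p q → T.Adj (e.symm p) (e.symm q) := by
    intro p q hpq
    rcases le_total (i' p) (i' q) with hle | hle
    · exact adj_of_isLevel_le hT H ha' hb' hb (hi' p) (hi' q) hle hpq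
    · exact (adj_of_isLevel_le hT H ha' hb' hb (hi' q) (hi' p) hle hpq.symm).symm
  refine ⟨⟨e, fun {p q} => ⟨fun hpq => by simpa using adj' hpq, adj⟩⟩, ?_, fun p => ⟨i p, rfl⟩⟩
  ext p
  have e3 : i (h p) = 1 + i p := by
    refine (hi _).unique hT H ha hb ⟨?_, ?_⟩
    · have := (inTranslate_apply_zpow p 1 (i p)).2 (hi p).1
      rwa [zpow_one] at this
    · have := (inTranslate_apply_zpow p 1 (i p + 1)).not.2 (hi p).2
      rwa [zpow_one, ← add_assoc] at this
  change (h' ^ i (h p) * (h ^ i (h p))⁻¹) (h p) = h' ((h' ^ i p * (h ^ i p)⁻¹) p)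
  rw [e3, ← RelIso.mul_apply, ← RelIso.mul_apply]
  congr 1
  rw [zpow_add, zpow_add]
  simp [mul_assoc]

end

end SimpleGraph

/-! ### Building automorphisms from local bijections -/

namespace SimpleGraph

variable {V : Type u} {T : SimpleGraph V}

/-- The next vertex on the geodesic from `u` to `p`. -/
noncomputable def toward (T : SimpleGraph V) (p u : V) : V :=
  open Classical in
  if h : ∃ v, T.Adj u v ∧ T.dist p v + 1 = T.dist p u then h.choose else u

theorem Connected.adj_toward (hT : T.Connected) {p u : V} (h : u ≠ p) :
    T.Adj u (T.toward p u) := by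
  have h' := hT.exists_adj_dist_add_one h
  rw [toward, dif_pos h']
  exact h'.choose_spec.1

theorem Connected.dist_toward (hT : T.Connected) {p u : V} (h : u ≠ p) :
    T.dist p (T.toward p u) + 1 = T.dist p u := by
  have h' := hT.exists_adj_dist_add_one h
  rw [toward, dif_pos h']
  exact h'.choose_spec.2

theorem IsTree.eq_toward (hT : T.IsTree) {p u v : V} (hv : T.Adj u v)
    (hd : T.dist p v < T.dist p u) : v = T.toward p u := by
  have h : u ≠ p := by
    rintro rfl
    simp at hd
  have h1 := hT.connected.dist_toward h
  exact hT.eq_of_adj_of_dist_lt hv (hT.connected.adj_toward h) hd (by omega)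

/-- Any bijection is corrected by composing with transpositions; the second leaves the first
prescribed value alone. The guards `P` and `Q` allow either prescription to be void. -/
theorem exists_bijOn_of_partial {α : Type*} {A B : Set α} (e : A ≃ B) {P Q : Prop} {a b a' b' : α}
    (hP : P → a ∈ A ∧ a' ∈ B) (hQ : Q → b ∈ A ∧ b' ∈ B) (hPQ : P → Q → a ≠ b ∧ a' ≠ b') :
    ∃ E : α → α, Set.BijOn E A B ∧ (P → E a = a') ∧ (Q → E b = b') := by
  classical
  have swap : ∀ {x y : α} {E : α → α}, x ∈ A → y ∈ B → Set.BijOn E A B →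
      Set.BijOn (Equiv.swap (E x) y ∘ E) A B := by
    intro x y E hx hy hE
    refine Set.BijOn.comp (t := B) ?_ hE
    have hm : Set.MapsTo (Equiv.swap (E x) y) B B := by
      intro z hz
      rw [Equiv.swap_apply_def]
      split_ifs
      · exact hy
      · exact hE.mapsTo hx
      · exact hz
    exact ⟨hm, (Equiv.injective _).injOn, fun z hz => ⟨_, hm hz, Equiv.swap_apply_self _ _ _⟩⟩
  obtain ⟨E₀, h₀⟩ : ∃ E : α → α, Set.BijOn E A B := by
    refine ⟨fun x => if h : x ∈ A then e ⟨x, h⟩ else x, ?_, ?_, ?_⟩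
    · intro x hx
      simp [hx]
    · intro x hx y hy hxy
      simp only [hx, hy, dif_pos] at hxy
      exact congrArg Subtype.val (e.injective (Subtype.ext hxy))
    · intro y hy
      exact ⟨e.symm ⟨y, hy⟩, (e.symm ⟨y, hy⟩).2, by simp⟩
  obtain ⟨E₁, h₁, ha⟩ : ∃ E : α → α, Set.BijOn E A B ∧ (P → E a = a') := by
    by_cases p : P
    · exact ⟨_, swap (hP p).1 (hP p).2 h₀, fun _ => by simp⟩
    · exact ⟨E₀, h₀, fun h => absurd h p⟩
  by_cases q : Q
  · refine ⟨_, swap (hQ q).1 (hQ q).2 h₁, fun p => ?_, fun _ => by simp⟩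
    have hne : E₁ a ≠ E₁ b := fun h => (hPQ p q).1 (h₁.injOn (hP p).1 (hQ q).1 h)
    rw [Function.comp_apply, Equiv.swap_apply_of_ne_of_ne hne]
    · exact ha p
    · rw [ha p]
      exact (hPQ p q).2
  · exact ⟨E₁, h₁, ha, fun h => absurd h q⟩

/-- The coloring `f` is proper, and any two vertices of the same color have equally many, and at
least three, neighbors. -/
structure IsHomogeneous (T : SimpleGraph V) (f : V → Fin 2) : Prop where
  ne_of_adj : ∀ {u v}, T.Adj u v → f u ≠ f v
  nonempty_equiv : ∀ {u w}, f u = f w → Nonempty (T.neighborSet u ≃ T.neighborSet w)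
  exists_adj_ne : ∀ v x y, ∃ z, T.Adj v z ∧ z ≠ x ∧ z ≠ y

/-- The vertex `u` lies on the geodesic from `p` to `q`. -/
def Between (T : SimpleGraph V) (p q u : V) : Prop :=
  T.dist p u + T.dist u q = T.dist p q

theorem Between.toward_ne (hT : T.IsTree) {p q u : V} (h : T.Between p q u) (hp : u ≠ p)
    (hq : u ≠ q) : T.toward p u ≠ T.toward q u := by
  intro e
  have h1 := hT.connected.dist_toward hp
  have h2 := hT.connected.dist_toward hq
  rw [e] at h1
  have h3 : T.dist p q ≤ T.dist p (T.toward q u) + T.dist (T.toward q u) q :=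
    hT.connected.dist_triangle
  rw [Between, dist_comm (u := u)] at h
  rw [dist_comm (u := T.toward q u) (v := q)] at h3
  omega

/-- The vertex map sending `p` to `p'` and, for `u` the neighbor of `v` towards `p`,
extending `u ↦ w` to `v ↦ E u w v`. -/
noncomputable def extendFrom (T : SimpleGraph V) (p p' : V) (E : V → V → V → V) (v : V) : V :=
  open Classical in
  -- Testing the distance rather than `v ≠ p` makes the recursion terminate without assuming
  -- connectedness.
  if T.dist p (T.toward p v) < T.dist p v then
    E (T.toward p v) (extendFrom T p p' E (T.toward p v)) v
  else p'
termination_by T.dist p v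

theorem extendFrom_self (p p' : V) (E : V → V → V → V) : T.extendFrom p p' E p = p' := by
  rw [extendFrom, if_neg (by simp)]

theorem Connected.extendFrom_of_ne (hT : T.Connected) {p v : V} (p' : V) (E : V → V → V → V)
    (h : v ≠ p) : T.extendFrom p p' E v =
      E (T.toward p v) (T.extendFrom p p' E (T.toward p v)) v := by
  have := hT.dist_toward h
  conv_lhs => rw [extendFrom]
  rw [if_pos (by omega)]

theorem Connected.induction_toward (hT : T.Connected) (p : V) {P : V → Prop} (h0 : P p)
    (h1 : ∀ v, v ≠ p → P (T.toward p v) → P v) (v : V) : P v := by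
  induction hn : T.dist p v generalizing v with
  | zero => rwa [← hT.dist_eq_zero_iff.1 hn]
  | succ n ih =>
    have hv : v ≠ p := by
      rintro rfl
      simp at hn
    have := hT.dist_toward hv
    exact h1 v hv (ih _ (by omega))

theorem eq_of_ne_of_ne {i j k : Fin 2} (h1 : i ≠ j) (h2 : k ≠ j) : i = k := by
  omega

section

variable {f : V → Fin 2} {p p' : V} {E : V → V → V → V} (hT : T.IsTree) (hf : T.IsHomogeneous f)
  (hpp : f p = f p')
  (hE : ∀ u w, f u = f w → Set.BijOn (E u w) (T.neighborSet u) (T.neighborSet w))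
  (hE' : ∀ u w, f u = f w → u ≠ p → w ≠ p' → E u w (T.toward p u) = T.toward p' w)
include hT hf hpp hE hE'

theorem extendFrom_color_dist (v : V) : f (T.extendFrom p p' E v) = f v ∧
    T.dist p' (T.extendFrom p p' E v) = T.dist p v := by
  induction v using hT.connected.induction_toward p with
  | h0 => simp [extendFrom_self, hpp]
  | h1 v hv ih =>
    obtain ⟨ih1, ih2⟩ := ih
    rw [hT.connected.extendFrom_of_ne p' E hv]
    set u := T.toward p v with hu
    set w := T.extendFrom p p' E u
    have huv : T.Adj v u := hT.connected.adj_toward hv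
    have hduv := hT.connected.dist_toward hv
    rw [← hu] at hduv
    have hw : T.Adj w (E u w v) := (hE u w ih1.symm).mapsTo huv.symm
    refine ⟨eq_of_ne_of_ne (hf.ne_of_adj hw).symm (ih1 ▸ hf.ne_of_adj huv), ?_⟩
    rcases hT.dist_eq_dist_add_one_of_adj p' hw with h | h
    -- If the image of `v` stepped back towards `p'`, it would coincide with the image of the
    -- neighbour of `u` towards `p`, against injectivity of `E u w`.
    · exfalso
      have hwp : w ≠ p' := by
        intro e
        rw [e] at h
        simp at h
      have hup : u ≠ p := by
        intro e
        rw [e, dist_self] at ih2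
        exact hwp (hT.connected.dist_eq_zero_iff.1 ih2).symm
      have h1 := hT.eq_toward (p := p') hw (by omega)
      rw [← hE' u w ih1.symm hup hwp] at h1
      have h2 := (hE u w ih1.symm).injOn huv.symm (hT.connected.adj_toward hup) h1
      have h3 := hT.connected.dist_toward hup
      rw [← h2] at h3
      omega
    · omega

theorem extendFrom_adj_toward {v : V} (hv : v ≠ p) :
    T.Adj (T.extendFrom p p' E (T.toward p v)) (T.extendFrom p p' E v) := by
  rw [hT.connected.extendFrom_of_ne p' E hv]
  exact (hE _ _ (extendFrom_color_dist hT hf hpp hE hE' _).1.symm).mapsTo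
    (hT.connected.adj_toward hv).symm

theorem toward_extendFrom {v : V} (hv : v ≠ p) :
    T.toward p' (T.extendFrom p p' E v) = T.extendFrom p p' E (T.toward p v) := by
  refine (hT.eq_toward (extendFrom_adj_toward hT hf hpp hE hE' hv).symm ?_).symm
  rw [(extendFrom_color_dist hT hf hpp hE hE' _).2, (extendFrom_color_dist hT hf hpp hE hE' _).2,
    ← hT.connected.dist_toward hv]
  omega

theorem extendFrom_ne {v : V} (hv : v ≠ p) : T.extendFrom p p' E v ≠ p' := by
  intro e
  have := (extendFrom_color_dist hT hf hpp hE hE' v).2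
  rw [e, dist_self] at this
  exact hv (hT.connected.dist_eq_zero_iff.1 this.symm).symm

theorem extendFrom_injective : Function.Injective (T.extendFrom p p' E) := by
  intro v v'
  induction v using hT.connected.induction_toward p generalizing v' with
  | h0 =>
    intro h
    by_contra hne
    rw [extendFrom_self] at h
    exact extendFrom_ne hT hf hpp hE hE' (Ne.symm hne) h.symm
  | h1 v hv ih =>
    intro h
    have hv' : v' ≠ p := by
      rintro rfl
      rw [extendFrom_self] at h
      exact extendFrom_ne hT hf hpp hE hE' hv h
    have h1 := toward_extendFrom hT hf hpp hE hE' hv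
    rw [h, toward_extendFrom hT hf hpp hE hE' hv'] at h1
    have h2 := ih h1.symm
    rw [hT.connected.extendFrom_of_ne p' E hv, hT.connected.extendFrom_of_ne p' E hv', ← h2] at h
    refine (hE _ _ (extendFrom_color_dist hT hf hpp hE hE' _).1.symm).injOn
      (hT.connected.adj_toward hv).symm ?_ h
    rw [h2]
    exact (hT.connected.adj_toward hv').symm

theorem extendFrom_surjective : Function.Surjective (T.extendFrom p p' E) := by
  intro w
  induction w using hT.connected.induction_toward p' with
  | h0 => exact ⟨p, extendFrom_self _ _ _⟩
  | h1 w hw ih => ?_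
  obtain ⟨u, hu⟩ := ih
  have hc := (extendFrom_color_dist hT hf hpp hE hE' u).1
  have hwu := hT.connected.adj_toward hw
  rw [← hu] at hwu
  obtain ⟨v, hv, rfl⟩ := (hE _ _ hc.symm).surjOn hwu.symm
  have hd := hT.connected.dist_toward hw
  rw [← hu] at hd
  have hpv : T.dist p u < T.dist p v := by
    by_contra hlt
    have h1 := hT.dist_ne_of_adj p hv
    have h2 := hT.eq_toward (p := p) hv (by omega)
    have hup : u ≠ p := by
      rintro rfl
      rw [dist_self] at hlt h1
      omega
    have h3 := hE' u _ hc.symm hup (extendFrom_ne hT hf hpp hE hE' hup)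
    rw [← h2] at h3
    rw [h3] at hd
    have h4 := hT.connected.dist_toward (extendFrom_ne hT hf hpp hE hE' hup)
    omega
  have h5 := hT.eq_toward hv.symm hpv
  refine ⟨v, ?_⟩
  rw [hT.connected.extendFrom_of_ne p' E (by rintro rfl; simp at hpv), ← h5]

theorem adj_extendFrom_iff {u v : V} :
    T.Adj (T.extendFrom p p' E u) (T.extendFrom p p' E v) ↔ T.Adj u v := by
  constructor
  · intro h
    wlog hlt : T.dist p u < T.dist p v generalizing u v
    · refine (this h.symm ?_).symm
      have h1 := hT.dist_ne_of_adj p' h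
      rw [(extendFrom_color_dist hT hf hpp hE hE' _).2,
        (extendFrom_color_dist hT hf hpp hE hE' _).2] at h1
      omega
    have hv : v ≠ p := by
      rintro rfl
      simp at hlt
    have h1 := hT.eq_toward (p := p') h.symm (by
      rwa [(extendFrom_color_dist hT hf hpp hE hE' _).2,
        (extendFrom_color_dist hT hf hpp hE hE' _).2])
    rw [toward_extendFrom hT hf hpp hE hE' hv] at h1
    rw [extendFrom_injective hT hf hpp hE hE' h1]
    exact (hT.connected.adj_toward hv).symm
  · intro h
    wlog hlt : T.dist p u < T.dist p v generalizing u v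
    · refine (this h.symm ?_).symm
      have h1 := hT.dist_ne_of_adj p h
      omega
    have hv : v ≠ p := by
      rintro rfl
      simp at hlt
    rw [hT.eq_toward h.symm hlt]
    exact extendFrom_adj_toward hT hf hpp hE hE' hv

end

/-- Color-preserving automorphisms act transitively on pairs of vertices at a given distance. -/
theorem IsHomogeneous.exists_iso {f : V → Fin 2} (hf : T.IsHomogeneous f) (hT : T.IsTree)
    {p q p' q' : V} (hp : f p = f p') (hd : T.dist p q = T.dist p' q') :
    ∃ α : T ≃g T, (∀ v, f (α v) = f v) ∧ α p = p' ∧ α q = q' := by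
  -- Besides respecting the direction back to `p`, the local bijections follow the geodesic to `q`,
  -- so that the extension carries it onto the geodesic from `p'` to `q'`.
  have hE : ∀ u w, ∃ E : V → V, f u = f w → Set.BijOn E (T.neighborSet u) (T.neighborSet w) ∧
      (u ≠ p ∧ w ≠ p' → E (T.toward p u) = T.toward p' w) ∧
      ((u ≠ q ∧ w ≠ q') ∧ T.Between p q u ∧ T.Between p' q' w →
        E (T.toward q u) = T.toward q' w) := by
    intro u w
    by_cases h : f u = f w
    · obtain ⟨e⟩ := hf.nonempty_equiv h
      obtain ⟨E, hE⟩ := exists_bijOn_of_partial e (P := u ≠ p ∧ w ≠ p')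
        (Q := (u ≠ q ∧ w ≠ q') ∧ T.Between p q u ∧ T.Between p' q' w)
        (a := T.toward p u) (a' := T.toward p' w) (b := T.toward q u) (b' := T.toward q' w)
        (fun h => ⟨hT.connected.adj_toward h.1, hT.connected.adj_toward h.2⟩)
        (fun h => ⟨hT.connected.adj_toward h.1.1, hT.connected.adj_toward h.1.2⟩)
        (fun h h' => ⟨h'.2.1.toward_ne hT h.1 h'.1.1, h'.2.2.toward_ne hT h.2 h'.1.2⟩)
      exact ⟨E, fun _ => hE⟩
    · exact ⟨id, fun h' => absurd h' h⟩
  choose E hE using hE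
  have h1 : ∀ u w, f u = f w → Set.BijOn (E u w) (T.neighborSet u) (T.neighborSet w) :=
    fun u w h => (hE u w h).1
  have h2 : ∀ u w, f u = f w → u ≠ p → w ≠ p' → E u w (T.toward p u) = T.toward p' w :=
    fun u w h hu hw => (hE u w h).2.1 ⟨hu, hw⟩
  have cd := extendFrom_color_dist hT hf hp h1 h2
  have hgeo : ∀ v, T.Between p q v → T.Between p' q' (T.extendFrom p p' E v) := by
    intro v
    induction v using hT.connected.induction_toward p with
    | h0 =>
      intro _
      simp [extendFrom_self, Between]
    | h1 v hv ih =>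
      intro hb
      have hd1 := hT.connected.dist_toward hv
      have huv := hT.connected.adj_toward hv
      have hub : T.Between p q (T.toward p v) := by
        have h3 : T.dist p q ≤ T.dist p (T.toward p v) + T.dist (T.toward p v) q :=
          hT.connected.dist_triangle
        have h4 := hT.dist_eq_dist_add_one_of_adj q huv
        rw [dist_comm (u := q), dist_comm (u := q)] at h4
        unfold Between at hb ⊢
        omega
      have hlt : T.dist q v < T.dist q (T.toward p v) := by
        unfold Between at hb hub
        rw [dist_comm (u := q), dist_comm (u := q)]
        omega
      have hvq := hT.eq_toward huv.symm hlt
      have hub' := ih hub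
      have hw2 := (cd (T.toward p v)).2
      have huq : T.toward p v ≠ q := by
        intro e
        rw [e] at hlt
        simp at hlt
      have hwq : T.extendFrom p p' E (T.toward p v) ≠ q' := by
        intro e
        rw [e] at hw2
        unfold Between at hub
        rw [dist_comm (u := q) (v := T.toward p v)] at hlt
        omega
      have hm := (hE _ _ (cd (T.toward p v)).1.symm).2.2 ⟨⟨huq, hwq⟩, hub, hub'⟩
      rw [← hvq, ← hT.connected.extendFrom_of_ne p' E hv] at hm
      have hd3 := hT.connected.dist_toward hwq
      rw [← hm] at hd3
      have hd4 := (cd v).2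
      unfold Between at hub' ⊢
      rw [dist_comm (v := q')] at hub' ⊢
      omega
  refine ⟨⟨Equiv.ofBijective _ ⟨extendFrom_injective hT hf hp h1 h2,
    extendFrom_surjective hT hf hp h1 h2⟩, adj_extendFrom_iff hT hf hp h1 h2⟩,
    fun v => (cd v).1, extendFrom_self _ _ _, ?_⟩
  have h3 := hgeo q (by simp [Between])
  have h4 := (cd q).2
  unfold Between at h3
  have h5 : T.dist (T.extendFrom p p' E q) q' = 0 := by omega
  exact hT.connected.dist_eq_zero_iff.1 h5

end SimpleGraph


/-! ### Products of conjugates -/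

/-- `h` is a product of at most `N` conjugates of `g` and `g⁻¹`. -/
def IsConjProduct {G : Type*} [Group G] (g : G) (N : ℕ) (h : G) : Prop :=
  ∃ L : List G, L.length ≤ N ∧ (∀ c ∈ L, IsConj g c ∨ IsConj g⁻¹ c) ∧ L.prod = h

namespace IsConjProduct

variable {G : Type*} [Group G] {g h h' : G} {M N : ℕ}

theorem refl (g : G) : IsConjProduct g 1 g :=
  ⟨[g], by simp, fun c hc => Or.inl (List.mem_singleton.1 hc ▸ IsConj.refl g), by simp⟩

theorem mono (hh : IsConjProduct g N h) (hMN : N ≤ M) : IsConjProduct g M h := by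
  obtain ⟨L, h1, h2, h3⟩ := hh
  exact ⟨L, h1.trans hMN, h2, h3⟩

theorem mul (hh : IsConjProduct g N h) (hh' : IsConjProduct g M h') :
    IsConjProduct g (N + M) (h * h') := by
  obtain ⟨L, h1, h2, h3⟩ := hh
  obtain ⟨L', h1', h2', h3'⟩ := hh'
  refine ⟨L ++ L', by simp; omega, ?_, by simp [h3, h3']⟩
  intro c hc
  rcases List.mem_append.1 hc with hc | hc
  · exact h2 c hc
  · exact h2' c hc

theorem inv (hh : IsConjProduct g N h) : IsConjProduct g N h⁻¹ := by
  obtain ⟨L, h1, h2, rfl⟩ := hh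
  refine ⟨(L.map (·⁻¹)).reverse, by simpa using h1, ?_, (List.prod_inv_reverse L).symm⟩
  intro c hc
  simp only [List.mem_reverse, List.mem_map] at hc
  obtain ⟨c, hc, rfl⟩ := hc
  have key : ∀ {x y : G}, IsConj x y → IsConj x⁻¹ y⁻¹ := by
    intro x y hxy
    obtain ⟨z, rfl⟩ := isConj_iff.1 hxy
    exact isConj_iff.2 ⟨z, by group⟩
  rcases h2 c hc with h | h
  · exact Or.inr (key h)
  · exact Or.inl (by simpa using key h)

theorem of_isConj (hh : IsConjProduct g N h) (hc : IsConj h h') : IsConjProduct g N h' := by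
  obtain ⟨L, h1, h2, rfl⟩ := hh
  obtain ⟨x, rfl⟩ := isConj_iff.1 hc
  refine ⟨L.map (MulAut.conj x), by simpa using h1, ?_, by
    rw [← map_list_prod, MulAut.conj_apply]⟩
  intro c hc
  obtain ⟨c', hc', rfl⟩ := List.mem_map.1 hc
  have key : IsConj c' (MulAut.conj x c') := isConj_iff.2 ⟨x, by simp⟩
  exact (h2 c' hc').imp (·.trans key) (·.trans key)

end IsConjProduct

/-! ### The colour-preserving group, its generation and its index -/

namespace SimpleGraph

variable {V : Type u} {T : SimpleGraph V} {f : V → Fin 2}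

/-- The group of automorphisms preserving the coloring `f`. -/
def colorPreserving (T : SimpleGraph V) (f : V → Fin 2) : Subgroup (T ≃g T) where
  carrier := {α | ∀ v, f (α v) = f v}
  one_mem' := fun _ => rfl
  mul_mem' := by
    intro α β hα hβ v
    rw [RelIso.mul_apply, hα, hβ]
  inv_mem' := by
    intro α hα v
    rw [← hα (α⁻¹ v), RelIso.apply_inv_self]

theorem IsBiregularTree.isHomogeneous {n m : Cardinal.{u}} (hn : 3 ≤ n) (hm : 3 ≤ m)
    (hT : T.IsBiregularTree f n m) : T.IsHomogeneous f := by
  have hcode := hT.hasCode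
  have hne : ∀ {u v}, T.Adj u v → f u ≠ f v := by
    intro u v huv e
    have h := hcode (f u) (f u) u rfl
    have h0 : biregularCode n m (f u) (f u) = 0 := by
      generalize f u = i
      fin_cases i <;> rfl
    rw [h0, Cardinal.mk_eq_zero_iff] at h
    exact h.false ⟨v, e.symm, huv⟩
  have hnb : ∀ u, Cardinal.mk (T.neighborSet u) = biregularCode n m (f u) (1 - f u) := by
    intro u
    rw [← hcode (f u) (1 - f u) u rfl]
    refine Cardinal.mk_congr (Equiv.subtypeEquivRight fun y => ⟨fun h => ⟨?_, h⟩, fun h => h.2⟩)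
    have := hne h
    omega
  have hge : ∀ i : Fin 2, 3 ≤ biregularCode n m i (1 - i) := by
    intro i
    fin_cases i
    · exact hn
    · exact hm
  refine ⟨hne, fun {u w} h => ?_, fun v x y => ?_⟩
  · rw [← Cardinal.eq, hnb, hnb, h]
  · by_contra! hc
    have hsub : T.neighborSet v ⊆ ({x, y} : Set V) := by
      intro z hz
      by_cases hzx : z = x
      · exact Or.inl hzx
      · exact Or.inr (hc z hz hzx)
    have h1 := (hge (f v)).trans ((hnb v).symm.le.trans (Cardinal.mk_le_mk_of_subset hsub))
    have h2 : Cardinal.mk ({x, y} : Set V) ≤ 2 := by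
      refine Cardinal.mk_insert_le.trans ?_
      rw [Cardinal.mk_singleton, one_add_one_eq_two]
    have h3 := h1.trans h2
    norm_cast at h3

theorem IsTree.eq_of_adj_adj (hT : T.IsTree) {x y w w' : V} (hxy : x ≠ y) (h1 : T.Adj x w)
    (h2 : T.Adj y w) (h1' : T.Adj x w') (h2' : T.Adj y w') : w = w' := by
  have h3 : T.dist y x = 2 := hT.dist_eq_two h2.symm h1.symm hxy.symm
  have h4 : T.dist y w = 1 := dist_eq_one_iff_adj.2 h2
  have h5 : T.dist y w' = 1 := dist_eq_one_iff_adj.2 h2'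
  exact hT.eq_of_adj_of_dist_lt (p := y) h1 h1' (by omega) (by omega)

namespace IsHomogeneous

variable (hf : T.IsHomogeneous f)
include hf

theorem color_iff_of_adj (α : T ≃g T) {u v : V} (huv : T.Adj u v) :
    f (α u) = f u ↔ f (α v) = f v := by
  have h1 := hf.ne_of_adj huv
  have h2 := hf.ne_of_adj (α.map_adj_iff.2 huv)
  omega

variable (hT : T.IsTree)
include hT

theorem color_iff (α : T ≃g T) (u v : V) : f (α v) = f v ↔ f (α u) = f u := by
  induction v using hT.connected.induction_toward u with
  | h0 => rfl
  | h1 v hv ih => rw [← ih, hf.color_iff_of_adj α (hT.connected.adj_toward hv)]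

theorem color_eq_iff_even (u v : V) : f u = f v ↔ Even (T.dist u v) := by
  induction v using hT.connected.induction_toward u with
  | h0 => simp
  | h1 v hv ih =>
    have h1 := hf.ne_of_adj (hT.connected.adj_toward hv)
    rw [← hT.connected.dist_toward hv, Nat.even_add_one, ← ih]
    omega

/-- Fix a third neighbour `z` of `w` and send `x` to `y`; the middle vertex `w` is then fixed too,
so the edge `wz` is fixed pointwise. -/
theorem exists_mem_autPlus_turn {w x y : V} (hx : T.Adj w x) (hy : T.Adj w y) :
    ∃ t ∈ T.autPlus, t w = w ∧ t x = y := by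
  obtain ⟨z, hz, hzx, hzy⟩ := hf.exists_adj_ne w x y
  obtain ⟨α, -, h1, h2⟩ := hf.exists_iso hT (p := z) (p' := z) (q := x) (q' := y) rfl
    (by rw [hT.dist_eq_two hz hx hzx, hT.dist_eq_two hz hy hzy])
  have h3 : T.Adj z (α w) := by
    have := α.map_adj_iff.2 hz.symm
    rwa [h1] at this
  have h4 : T.Adj y (α w) := by
    have := α.map_adj_iff.2 hx.symm
    rwa [h2] at this
  have h5 : α w = w := hT.eq_of_adj_adj hzy h3 h4 hz.symm hy.symm
  refine ⟨α, ?_, h5, h2⟩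
  have : T.pairStabilizer w z ≤ T.autPlus :=
    le_iSup_of_le w (le_iSup_of_le z (le_iSup_of_le hz le_rfl))
  exact this ⟨h5, h1⟩

theorem autPlus_le : T.autPlus ≤ T.colorPreserving f := by
  refine iSup_le fun x => iSup_le fun y => iSup_le fun _ α hα v => ?_
  rw [hf.color_iff hT α x, hα.1]

/-- Turns move every edge onto a fixed edge `xy`, up to orientation. For the image of `xy` under a
colour-preserving `α` the reversed orientation is excluded by colours, so `α` differs from an
element of `autPlus` by a stabilizer of `xy`. -/
theorem autPlus_eq : T.autPlus = T.colorPreserving f := by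
  refine le_antisymm (hf.autPlus_le hT) fun α hα => ?_
  obtain ⟨x⟩ := hT.connected.nonempty
  obtain ⟨y, hxy, -⟩ := hf.exists_adj_ne x x x
  have key : ∀ v w, T.Adj v w → ∃ s ∈ T.autPlus, (s v = x ∧ s w = y) ∨ (s v = y ∧ s w = x) := by
    intro v
    induction v using hT.connected.induction_toward x with
    | h0 =>
      intro w hw
      obtain ⟨t, ht, h1, h2⟩ := hf.exists_mem_autPlus_turn hT hw hxy
      exact ⟨t, ht, Or.inl ⟨h1, h2⟩⟩
    | h1 v hv ih =>
      intro w hw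
      have hv' := hT.connected.adj_toward hv
      obtain ⟨t, ht, h1, h2⟩ := hf.exists_mem_autPlus_turn hT hw hv'
      obtain ⟨s, hs, h3⟩ := ih v hv'.symm
      refine ⟨s * t, mul_mem hs ht, ?_⟩
      rw [RelIso.mul_apply, RelIso.mul_apply, h1, h2]
      exact h3.symm.imp And.symm And.symm
  obtain ⟨s, hs, h | h⟩ := key (α x) (α y) (α.map_adj_iff.2 hxy)
  · have h1 : s * α ∈ T.autPlus := by
      have : T.pairStabilizer x y ≤ T.autPlus :=
        le_iSup_of_le x (le_iSup_of_le y (le_iSup_of_le hxy le_rfl))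
      exact this h
    simpa using mul_mem (inv_mem hs) h1
  · exfalso
    have h1 := hf.autPlus_le hT hs (α x)
    rw [hα x, h.1] at h1
    exact hf.ne_of_adj hxy h1.symm

theorem index_colorPreserving :
    (T.colorPreserving f).index ≠ 0 ∧ (T.colorPreserving f).index ≤ 2 := by
  by_cases h : T.colorPreserving f = ⊤
  · simp [h]
  · have : (T.colorPreserving f).index = 2 := by
      obtain ⟨x⟩ := hT.connected.nonempty
      have hmem : ∀ α : T ≃g T, α ∈ T.colorPreserving f ↔ f (α x) = f x := fun α =>
        ⟨fun h => h x, fun h v => (hf.color_iff hT α x v).2 h⟩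
      obtain ⟨a, -, ha⟩ := SetLike.exists_of_lt (lt_top_iff_ne_top.2 h)
      refine Subgroup.index_eq_two_iff_exists_notMem_and.2 ⟨a, ha, fun b => ?_⟩
      have h1 := hf.color_iff hT b x (a x)
      rw [hmem] at ha
      rw [hmem, hmem, RelIso.mul_apply]
      omega
    omega

/-! ### Bounded simplicity -/

omit hf in
theorem isConj_of_coherent {a b c d : V} (H : T.Coherent a b c d) {h h' : T.colorPreserving f}
    (ha : h.1 a = c) (hb : h.1 b = d) (ha' : h'.1 a = c) (hb' : h'.1 b = d) : IsConj h h' := by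
  obtain ⟨x, hx, hk⟩ := exists_conj_of_coherent hT H ha hb ha' hb'
  have hmem : x ∈ T.colorPreserving f := by
    intro v
    obtain ⟨k, hk⟩ := hk v
    rw [hk]
    exact mul_mem (zpow_mem h'.2 k) (inv_mem (zpow_mem h.2 k)) v
  exact isConj_iff.2 ⟨⟨x, hmem⟩, Subtype.ext (mul_inv_eq_iff_eq_mul.2 hx)⟩

/-- Conjugate `h` to `h₁` carrying an edge `xy` to `vc'`, where `x` lies in a direction `r'` at `v`
other than `c'` and `e c'`. Then `e * h₁` carries `xy` to the edge from `v` to `e c'`, still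
pointing away from `x`, hence is a translation conjugate to `h₁`. -/
theorem exists_eq_mul_inv_of_fixed {a b c d v : V} (H : T.Coherent a b c d)
    {h e : T.colorPreserving f} (ha : h.1 a = c) (hb : h.1 b = d) (hv : e.1 v = v)
    (hav : f a = f v) :
    ∃ h₁ h₂, IsConj h h₁ ∧ IsConj h h₂ ∧ e = h₂ * h₁⁻¹ := by
  obtain ⟨c', hc', -⟩ := hf.exists_adj_ne v v v
  obtain ⟨r', hr', hrc, hre⟩ := hf.exists_adj_ne v c' (e.1 c')
  have hec : T.Adj v (e.1 c') := by
    have := e.1.map_adj_iff.2 hc'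
    rwa [hv] at this
  have hcv : f c = f v := by rw [← ha, h.2, hav]
  have hmid := H.dist_mid hT
  have hca : c ≠ a := by
    rintro rfl
    simp at hmid
  have hr := hT.connected.adj_toward hca
  have hrd := hT.connected.dist_toward hca
  set r := T.toward a c
  have hdr : d ≠ r := by
    rintro e
    have := H.dist_eq
    rw [e] at this
    omega
  obtain ⟨α, hα, hαd, hαr⟩ := hf.exists_iso hT (p := d) (p' := c') (q := r) (q' := r')
    (eq_of_ne_of_ne (hf.ne_of_adj H.adj_right).symm (hcv ▸ (hf.ne_of_adj hc').symm))
    (by rw [hT.dist_eq_two H.adj_right hr hdr, hT.dist_eq_two hc' hr' hrc.symm])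
  have hαc : α c = v := by
    have h1 := α.map_adj_iff.2 H.adj_right.symm
    have h2 := α.map_adj_iff.2 hr.symm
    rw [hαd] at h1
    rw [hαr] at h2
    exact hT.eq_of_adj_adj hrc.symm h1 h2 hc'.symm hr'.symm
  have H₁ := H.map α
  rw [hαc, hαd] at H₁
  have hrlt : T.dist (α a) r' < T.dist (α a) v := by
    rw [← hαr, ← hαc, Iso.dist_apply, Iso.dist_apply]
    omega
  generalize hx : α a = x at H₁ hrlt
  generalize hy : α b = y at H₁
  have hxe := hT.dist_eq_add_one_of_ne hr' hec hrlt hre.symm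
  have hxc := hT.dist_eq_add_one_of_ne hr' hc' hrlt hrc.symm
  have H₂ : T.Coherent x y v (e.1 c') := ⟨H₁.adj_left, hec, by rw [hxe, ← hxc, H₁.dist_eq]⟩
  let A : T.colorPreserving f := ⟨α, hα⟩
  have h₁x : (A * h * A⁻¹).1 x = v := by
    change α (h.1 (α⁻¹ x)) = v
    rw [← hx, RelIso.inv_apply_self, ha, hαc]
  have h₁y : (A * h * A⁻¹).1 y = c' := by
    change α (h.1 (α⁻¹ y)) = c'
    rw [← hy, RelIso.inv_apply_self, hb, hαd]
  have hc₁ : IsConj h (A * h * A⁻¹) := isConj_iff.2 ⟨A, rfl⟩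
  generalize A * h * A⁻¹ = h₁ at h₁x h₁y hc₁
  -- Since `γ` fixes `x`, `y` and `v`, conjugating `h₁` by it gives a translation with the same
  -- effect on `xy` as `e * h₁`.
  obtain ⟨γ, hγ, hγx, hγc⟩ := hf.exists_iso hT (p := x) (p' := x) (q := c') (q' := e.1 c') rfl
    (by rw [hxe, hxc])
  have hγv : γ v = v := by
    have h1 := γ.map_adj_iff.2 hc'.symm
    have h2 := Iso.dist_apply γ x v
    rw [hγc] at h1
    rw [hγx] at h2
    exact hT.eq_of_adj_of_dist_lt (p := x) h1 hec.symm (by omega) (by omega)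
  have hγy : γ y = y := by
    have h1 := γ.map_adj_iff.2 H₁.adj_left
    have h2 := Iso.dist_apply γ c' y
    have h3 := H₁.dist_right hT
    have h4 := H₂.dist_right hT
    have h5 := H₁.dist_eq
    have h6 := H₂.dist_eq
    rw [hγx] at h1
    rw [hγc] at h2
    rw [dist_comm (u := y)] at h3 h4
    rw [dist_comm (u := x)] at h5 h6
    exact hT.eq_of_adj_of_dist_lt (p := e.1 c') h1 H₁.adj_left (by omega) (by omega)
  let C : T.colorPreserving f := ⟨γ, hγ⟩
  refine ⟨h₁, e * h₁, hc₁, (hc₁.trans (isConj_iff.2 ⟨C, rfl⟩)).trans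
    (isConj_of_coherent hT H₂ (h := C * h₁ * C⁻¹) ?_ ?_ ?_ ?_), by simp⟩
  · change γ (h₁.1 (γ⁻¹ x)) = v
    rw [← hγx, RelIso.inv_apply_self, h₁x, hγv]
  · change γ (h₁.1 (γ⁻¹ y)) = e.1 c'
    rw [← hγy, RelIso.inv_apply_self, h₁y, hγc]
  · change e.1 (h₁.1 x) = v
    rw [h₁x, hv]
  · change e.1 (h₁.1 y) = e.1 c'
    rw [h₁y]

theorem isConjProduct_of_fixed {a b c d v : V} (H : T.Coherent a b c d)
    {g h e : T.colorPreserving f} {N : ℕ} (hg : IsConjProduct g N h)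
    (ha : h.1 a = c) (hb : h.1 b = d) (hv : e.1 v = v) : IsConjProduct g (N + N) e := by
  by_cases hav : f a = f v
  · obtain ⟨h₁, h₂, e1, e2, rfl⟩ := hf.exists_eq_mul_inv_of_fixed hT H ha hb hv hav
    exact (hg.of_isConj e2).mul (hg.of_isConj e1).inv
  -- For the other colour, reverse the axis: `h⁻¹` carries `dc` to `ba`.
  · have hdv : f d = f v := by
      rw [← hb, h.2]
      have := hf.ne_of_adj H.adj_left
      omega
    obtain ⟨h₁, h₂, e1, e2, rfl⟩ := hf.exists_eq_mul_inv_of_fixed hT H.symm (h := h⁻¹)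
      (by change h.1⁻¹ d = b; rw [← hb, RelIso.inv_apply_self])
      (by change h.1⁻¹ c = a; rw [← ha, RelIso.inv_apply_self]) hv hdv
    exact (hg.inv.of_isConj e2).mul (hg.inv.of_isConj e1).inv

/-- Every color-preserving automorphism is a product of two that fix a vertex. -/
theorem exists_eq_mul_of_fixed (t : T.colorPreserving f) :
    ∃ e₁ e₂ : T.colorPreserving f, (∃ v, e₁.1 v = v) ∧ (∃ v, e₂.1 v = v) ∧ t = e₁ * e₂ := by
  obtain ⟨p⟩ := hT.connected.nonempty
  obtain ⟨k, hk⟩ := (hf.color_eq_iff_even hT p (t.1 p)).1 (t.2 p).symm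
  -- Colours make the distance from `p` to `t p` even, so there is a midpoint `q`; a rotation `α`
  -- about `q` brings `t p` back to `p`.
  obtain ⟨q, h1, h2⟩ := hT.connected.exists_dist_eq_of_le (p := p) (q := t.1 p) (k := k) (by omega)
  obtain ⟨α, hα, hq, hp⟩ := hf.exists_iso hT (p := q) (p' := q) (q := t.1 p) (q' := p) rfl
    (by rw [dist_comm (v := p)]; omega)
  let A : T.colorPreserving f := ⟨α, hα⟩
  refine ⟨A⁻¹, A * t, ⟨q, ?_⟩, ⟨p, hp⟩, by simp⟩
  change α⁻¹ q = q
  conv_lhs => rw [← hq]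
  exact RelIso.inv_apply_self _ _

/-- Let `g` fix `v` but move its neighbour `w`, and let a conjugate `k` fix another neighbour `x` of
`w` while moving `w`. Then `v, w, x, k w, k v, k (g w)` never backtracks, and `k * g` carries its
first edge to its last. -/
theorem exists_coherent_of_fixed {g : T.colorPreserving f} (hg : g ≠ 1) {p : V}
    (hp : g.1 p = p) : ∃ (h : T.colorPreserving f) (a b : V), IsConjProduct g 2 h ∧
      T.Coherent a b (h.1 a) (h.1 b) := by
  obtain ⟨v, w, hv, hvw, hw⟩ : ∃ v w, g.1 v = v ∧ T.Adj v w ∧ g.1 w ≠ w := by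
    by_contra! hc
    refine hg (Subtype.ext (RelIso.ext fun v => ?_))
    change g.1 v = v
    induction v using hT.connected.induction_toward p with
    | h0 => exact hp
    | h1 v hv ih => exact hc _ _ ih (hT.connected.adj_toward hv).symm
  obtain ⟨x, hwx, hxv, -⟩ := hf.exists_adj_ne w v v
  obtain ⟨α, hα, hαw, hαv⟩ := hf.exists_iso hT (p := w) (p' := w) (q := v) (q' := x) rfl
    (by rw [dist_eq_one_iff_adj.2 hwx, dist_eq_one_iff_adj.2 hvw.symm])
  let A : T.colorPreserving f := ⟨α, hα⟩
  have kx : (A * g * A⁻¹).1 x = x := by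
    change α (g.1 (α⁻¹ x)) = x
    rw [← hαv, RelIso.inv_apply_self, hv]
  have kw : (A * g * A⁻¹).1 w ≠ w := by
    change α (g.1 (α⁻¹ w)) ≠ w
    intro h
    have h1 : α⁻¹ w = w := by
      conv_lhs => rw [← hαw]
      exact RelIso.inv_apply_self _ _
    rw [h1] at h
    exact hw (α.injective (h.trans hαw.symm))
  have kg : IsConjProduct g 2 (A * g * A⁻¹ * g) :=
    ((IsConjProduct.refl g).of_isConj (isConj_iff.2 ⟨A, rfl⟩)).mul (IsConjProduct.refl g)
  generalize A * g * A⁻¹ = k at kx kw kg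
  refine ⟨k * g, v, w, kg, ?_⟩
  change T.Coherent v w (k.1 (g.1 v)) (k.1 (g.1 w))
  rw [hv]
  have ax : T.Adj x (k.1 w) := by
    have := k.1.map_adj_iff.2 hwx.symm
    rwa [kx] at this
  have av : T.Adj (k.1 w) (k.1 v) := k.1.map_adj_iff.2 hvw.symm
  have ag : T.Adj (k.1 v) (k.1 (g.1 w)) := by
    have := g.1.map_adj_iff.2 hvw
    rw [hv] at this
    exact k.1.map_adj_iff.2 this
  have nx : k.1 v ≠ x := fun h => hxv (k.1.injective (kx.trans h.symm))
  have ng : k.1 (g.1 w) ≠ k.1 w := fun h => hw (k.1.injective h)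
  have v1 : T.dist v w = 1 := dist_eq_one_iff_adj.2 hvw
  have v2 := hT.dist_eq_add_one_of_ne (p := v) hvw.symm hwx (by simp [v1]) hxv
  have v3 := hT.dist_eq_add_one_of_ne (p := v) hwx.symm ax (by omega) kw
  have v4 := hT.dist_eq_add_one_of_ne (p := v) ax.symm av (by omega) nx
  have v5 := hT.dist_eq_add_one_of_ne (p := v) av.symm ag (by omega) ng
  have w1 : T.dist w x = 1 := dist_eq_one_iff_adj.2 hwx
  have w2 := hT.dist_eq_add_one_of_ne (p := w) hwx.symm ax (by simp [w1]) kw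
  have w3 := hT.dist_eq_add_one_of_ne (p := w) ax.symm av (by omega) nx
  exact ⟨hvw, ag, by omega⟩

/-- Take `p` of minimal displacement and `b` the next vertex towards `g p`. If `g b` lay back
towards `p`, then `b` would be displaced by two less; the degenerate case `b = g p` is excluded by
colours. -/
theorem exists_coherent_of_forall_ne {g : T.colorPreserving f} (hg : ∀ v, g.1 v ≠ v) :
    ∃ a b, T.Coherent a b (g.1 a) (g.1 b) := by
  have := hT.connected.nonempty
  obtain ⟨p, hp⟩ : ∃ p, ∀ q, T.dist p (g.1 p) ≤ T.dist q (g.1 q) :=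
    ⟨Function.argmin fun v => T.dist v (g.1 v),
      fun q => Function.argmin_le (f := fun v => T.dist v (g.1 v)) q⟩
  have hpb := hT.connected.adj_toward (p := g.1 p) (hg p).symm
  have hd := hT.connected.dist_toward (p := g.1 p) (hg p).symm
  set b := T.toward (g.1 p) p
  have hgb := g.1.map_adj_iff.2 hpb
  have c1 : T.dist (g.1 p) p = T.dist p (g.1 p) := dist_comm
  have c2 : T.dist (g.1 p) b = T.dist b (g.1 p) := dist_comm
  refine ⟨p, b, hpb, hgb, ?_⟩
  rcases hT.dist_eq_dist_add_one_of_adj p hgb with h | h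
  · exfalso
    have hbg : b ≠ g.1 p := by
      intro e
      have h1 := hf.ne_of_adj hpb
      rw [e, g.2] at h1
      exact h1 rfl
    have hr := hT.connected.adj_toward hbg.symm
    have hrd := hT.connected.dist_toward hbg.symm
    have h1 : T.dist p (T.toward b (g.1 p)) ≤ T.dist p b + T.dist b (T.toward b (g.1 p)) :=
      hT.connected.dist_triangle
    have h2 : T.dist p b = 1 := dist_eq_one_iff_adj.2 hpb
    have h3 : g.1 b = T.toward b (g.1 p) := by
      rcases hT.dist_eq_dist_add_one_of_adj p hr with h4 | h4
      · exact hT.eq_of_adj_of_dist_lt (p := p) hgb hr (by omega) (by omega)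
      · omega
    have h4 := hp b
    rw [h3] at h4
    omega
  · omega

theorem isBoundedlySimple_colorPreserving : IsBoundedlySimple 8 (T.colorPreserving f) := by
  intro g hg t
  obtain ⟨h, a, b, hh, H⟩ : ∃ (h : T.colorPreserving f) (a b : V), IsConjProduct g 2 h ∧
      T.Coherent a b (h.1 a) (h.1 b) := by
    by_cases hfix : ∃ p, g.1 p = p
    · obtain ⟨p, hp⟩ := hfix
      exact hf.exists_coherent_of_fixed hT hg hp
    · push Not at hfix
      obtain ⟨a, b, H⟩ := hf.exists_coherent_of_forall_ne hT hfix
      exact ⟨g, a, b, (IsConjProduct.refl g).mono one_le_two, H⟩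
  obtain ⟨e₁, e₂, ⟨v₁, h₁⟩, ⟨v₂, h₂⟩, rfl⟩ := hf.exists_eq_mul_of_fixed hT t
  -- Each factor costs `2 + 2` conjugates, since `h` costs 2.
  exact (hf.isConjProduct_of_fixed hT H hh rfl rfl h₁).mul
    (hf.isConjProduct_of_fixed hT H hh rfl rfl h₂)

end IsHomogeneous

end SimpleGraph

theorem IsBoundedlySimple.mono {M N : ℕ} {G : Type*} [Group G] (h : IsBoundedlySimple M G)
    (hMN : M ≤ N) : IsBoundedlySimple N G := by
  intro g hg t
  obtain ⟨L, h1, h2⟩ := h g hg t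
  exact ⟨L, h1.trans hMN, h2⟩

theorem theorem3 {V : Type u} (T : SimpleGraph V) (f : V → Fin 2) (n m : Cardinal.{u})
    (hn : 3 ≤ n) (hm : 3 ≤ m) (hT : T.IsBiregularTree f n m) :
    (T.autPlus.index ≠ 0 ∧ T.autPlus.index ≤ 2) ∧ IsBoundedlySimple 32 T.autPlus := by
  have hf := hT.isHomogeneous hn hm
  rw [hf.autPlus_eq hT.isTree]
  exact ⟨hf.index_colorPreserving hT.isTree,
    (hf.isBoundedlySimple_colorPreserving hT.isTree).mono (by norm_num)⟩
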